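/- Let $U\subset\mathbb R^3$ be open and connected and let $f:U\to\mathbb R^3$ be a Guichard net, i.e. a smooth map with $\det(\partial_1 f,\partial_2 f,\partial_3 f)\neq 0$, $(\partial_i f,\partial_j f)=0$ for $i\ne j$, whose Lamé coefficients $H_i$ (defined by $\partial_i f=H_iN_i$, where $N_i=\frac{\partial_j f\times\partial_k f}{|\partial_j f\times\partial_k f|}$ for $(i,j,k)$ cyclic) satisfy $H_1^2+H_2^2-H_3^2=0$. Put $(\varepsilon_1,\varepsilon_2,\varepsilon_3)=(1,1,-1)$, and let $\kappa_{ij}$ be the principal curvature, with respect to $N_i$, of the coordinate surfaces $x_i=\mathrm{const}$ in the direction of $\partial_j f$. A Combescure transform of $f$ with factors $h_1,h_2,h_3$ is a smooth map $\hat f$ with $d\hat f=h_1\partial_xf\,dx+h_2\partial_yf\,dy+h_3\partial_zf\,dz$ (the factors may have zeros); its coefficients are $\hat H_i=h_iH_i$ and its principal curvatures with respect to the $N_i$ are $\hat\kappa_{ij}=\kappa_{ij}/h_j$. It is an associated system of the Guichard net $f$ if there is locally a Combescure transform $f^\star$ of $f$ (a dual system) with factors $h_i^\star=-h_i^2+\varepsilon_i/H_i^2$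 such that $$\frac1{\kappa_{ij}\kappa^\star_{ik}}+\frac1{\kappa_{ik}\kappa^\star_{ij}}=-\frac2{\hat\kappa_{ij}\hat\kappa_{ik}},\qquad\text{understood as}\quad h_j^\star+h_k^\star=-2h_jh_k\quad (j\neq k).$$ Then: (1) A smooth map $\hat f:U\to\mathbb R^3$ is an associated system of $f$ if and only if, after replacing $\hat f$ by $-\hat f$ if necessary, $$d\hat f=h_1\partial_xf\,dx+h_2\partial_yf\,dy+h_3\partial_zf\,dz$$ with smooth functions $h_1,h_2,h_3$ on $U$ satisfying $$\partial_xh_3=-\frac{H_2}{H_3}\kappa_{13},\quad \partial_yh_3=\frac{H_1}{H_3}\kappa_{23},\quad \partial_zh_3=-\frac{H_1H_2}{H_3^2}(\kappa_{31}-\kappa_{32}),$$ $$h_1=h_3+\frac{H_2}{H_1H_3},\qquad h_2=h_3-\frac{H_1}{H_2H_3}.$$ (2) Every associated system satisfies $\hat H_1^2+\hat H_2^2-\hat H_3^2=1$; in particular, if $\det(\partial_1\hat f,\partial_2\hat f,\partial_3\hat f)$ vanishes nowhere on $U$, then $\hat f$ is a triply orthogonal system whose own Lamé coefficients satisfy this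 relation, i.e. a $1$-system. (3) If $U$ is simply connected, then for all $p\in U$, $c\in\mathbb R$, $q\in\mathbb R^3$ there are $h_1,h_2,h_3$ and $\hat f$ as in (1), without change of sign, with $h_3(p)=c$ and $\hat f(p)=q$. -/

import Mathlib

open scoped ContDiff

noncomputable section

namespace GuichardNet

/-- Euclidean three-space. The coordinates `x, y, z` (or `x₁, x₂, x₃`) have the indices `0, 1, 2`. -/
abbrev R3 : Type := EuclideanSpace ℝ (Fin 3)

/-- The partial derivative `∂ᵢ g`; used only at interior points of domains on which `g` is smooth. -/
def pderiv {G : Type*} [NormedAddCommGroup G] [NormedSpace ℝ G] (i : Fin 3) (g : R3 → G) (x : R3) :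
    G :=
  fderiv ℝ g x (EuclideanSpace.single i 1)

/-- The usual cross product on `ℝ³`. -/
def cross (a b : R3) : R3 := WithLp.toLp 2 (crossProduct (WithLp.ofLp a) (WithLp.ofLp b))

/-- `det (∂ₓ f, ∂_y f, ∂_z f)`. -/
def jacobian (f : R3 → R3) (x : R3) : ℝ :=
  Matrix.det (Matrix.of fun a i : Fin 3 => pderiv i f x a)

/-- `f` is a (smooth) triply orthogonal system on the open connected set `U`. -/
structure IsTriplyOrthogonalSystem (U : Set R3) (f : R3 → R3) : Prop where
  isOpen : IsOpen U
  isConnected : IsConnected U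
  smooth : ContDiffOn ℝ ∞ f U
  jacobian_ne_zero : ∀ x ∈ U, jacobian f x ≠ 0
  orthogonal : ∀ x ∈ U, ∀ i j : Fin 3, i ≠ j → inner ℝ (pderiv i f x) (pderiv j f x) = 0

/-- The unit normal `Nᵢ = ∂ⱼ f × ∂ₖ f / |∂ⱼ f × ∂ₖ f|` of the coordinate surfaces `xᵢ = const`, where
`(i, j, k)` is a cyclic permutation of the three indices (addition in `Fin 3` is modulo three). -/
def unitNormal (f : R3 → R3) (i : Fin 3) (x : R3) : R3 :=
  ‖cross (pderiv (i + 1) f x) (pderiv (i + 2) f x)‖⁻¹ •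
    cross (pderiv (i + 1) f x) (pderiv (i + 2) f x)

/-- The Lamé coefficient `Hᵢ`, determined by `∂ᵢ f = Hᵢ Nᵢ`. -/
def lame (f : R3 → R3) (i : Fin 3) (x : R3) : ℝ :=
  inner ℝ (pderiv i f x) (unitNormal f i x)

/-- The principal curvature `κᵢⱼ` of the coordinate surfaces `xᵢ = const` in the direction of the
`xⱼ`-lines, which are curvature lines by Dupin's theorem: the quotient of the second fundamental form
with respect to the unit normal `Nᵢ` and the first fundamental form on `∂ⱼ f`. -/
def principalCurvature (f : R3 → R3) (i j : Fin 3) (x : R3) : ℝ :=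
  inner ℝ (pderiv j (pderiv j f) x) (unitNormal f i x) /
    inner ℝ (pderiv j f x) (pderiv j f x)

/-- A `χ`-system: a triply orthogonal system with `H₁² + H₂² - H₃² = χ`. -/
def IsChiSystem (U : Set R3) (f : R3 → R3) (χ : R3 → ℝ) : Prop :=
  IsTriplyOrthogonalSystem U f ∧
    ∀ x ∈ U, lame f 0 x ^ 2 + lame f 1 x ^ 2 - lame f 2 x ^ 2 = χ x

/-- A Guichard net is a `0`-system. -/
def IsGuichardNet (U : Set R3) (f : R3 → R3) : Prop := IsChiSystem U f fun _ => 0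

/-- `g` is the Combescure transform of `f` on `U` with factors `h₁, h₂, h₃`:
`dg = h₁ ∂ₓ f dx + h₂ ∂_y f dy + h₃ ∂_z f dz`. The factors may have zeros, so `g` may degenerate. -/
def IsCombescureTransform (U : Set R3) (f : R3 → R3) (h : Fin 3 → R3 → ℝ) (g : R3 → R3) : Prop :=
  ContDiffOn ℝ ∞ g U ∧ ∀ x ∈ U, ∀ i : Fin 3, pderiv i g x = h i x • pderiv i f x

/-- The signs `(ε₁, ε₂, ε₃) = (1, 1, -1)` of the Guichard condition. -/
def guichardSign : Fin 3 → ℝ := ![1, 1, -1]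

/-- `g` is an associated system of the Guichard net `f` on `U`: it is a Combescure transform of `f`,
with factors `hᵢ`, and locally there is another Combescure transform `f⋆` of `f`, with factors `hᵢ⋆`
(a dual system), such that

* the principal curvatures satisfy `1/(κᵢⱼ κᵢₖ⋆) + 1/(κᵢₖ κᵢⱼ⋆) = -2/(κ̂ᵢⱼ κ̂ᵢₖ)`. Since
  `κ̂ᵢⱼ = κᵢⱼ / hⱼ` and `κᵢⱼ⋆ = κᵢⱼ / hⱼ⋆` with respect to the common normals `Nᵢ`, this reads
  `hⱼ⋆ + hₖ⋆ = -2 hⱼ hₖ`, and is stated in this form in order to make sense (and be a condition) also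
  where some of the curvatures or factors vanish;
* the pair `(g, f⋆)` is normalized by the Guichard coordinates, `hᵢ⋆ = -hᵢ² + εᵢ / Hᵢ²`; in
  particular it is non-trivial, that is, `hᵢ⋆ ≠ -hᵢ²`. -/
def IsAssociatedSystem (U : Set R3) (f g : R3 → R3) : Prop :=
  ∃ h : Fin 3 → R3 → ℝ, IsCombescureTransform U f h g ∧
    ∀ p ∈ U, ∃ V : Set R3, IsOpen V ∧ p ∈ V ∧ V ⊆ U ∧
      ∃ (hstar : Fin 3 → R3 → ℝ) (fstar : R3 → R3),
        IsCombescureTransform V f hstar fstar ∧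
        (∀ x ∈ V, ∀ j k : Fin 3, j ≠ k → hstar j x + hstar k x = -2 * h j x * h k x) ∧
        (∀ x ∈ V, ∀ i : Fin 3, hstar i x = -h i x ^ 2 + guichardSign i / lame f i x ^ 2)

/-- The first order system for `h₃`, together with the formulas for `h₁` and `h₂`. -/
structure SolvesAssociatedEquations (U : Set R3) (f : R3 → R3) (h : Fin 3 → R3 → ℝ) : Prop where
  smooth : ∀ i : Fin 3, ContDiffOn ℝ ∞ (h i) U
  dx : ∀ x ∈ U, pderiv 0 (h 2) x = -(lame f 1 x / lame f 2 x) * principalCurvature f 0 2 x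
  dy : ∀ x ∈ U, pderiv 1 (h 2) x = lame f 0 x / lame f 2 x * principalCurvature f 1 2 x
  dz : ∀ x ∈ U, pderiv 2 (h 2) x = -(lame f 0 x * lame f 1 x / lame f 2 x ^ 2) *
    (principalCurvature f 2 0 x - principalCurvature f 2 1 x)
  fst : ∀ x ∈ U, h 0 x = h 2 x + lame f 1 x / (lame f 0 x * lame f 2 x)
  snd : ∀ x ∈ U, h 1 x = h 2 x - lame f 0 x / (lame f 1 x * lame f 2 x)

end GuichardNet

end

/-! Indices run over 0, 1, 2 as in the code. Eliminating the dual factors turns the curvature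
condition into `εⱼ/Hⱼ² + εₖ/Hₖ² = (hⱼ - hₖ)²`. By the Guichard relation this fixes `h₀ - h₂ = σ
H₁/(H₀H₂)` and `h₁ - h₂ = -σ H₀/(H₁H₂)` with a sign `σ` (`factor_differences_of_squares`), which is
constant because `U` is connected; passing to `σ • g` gives `σ = 1`.

The form `∑ hᵢ ∂ᵢf dxᵢ` is closed exactly when `Hᵢ ∂ⱼhᵢ = (hⱼ - hᵢ) ∂ⱼHᵢ` for `i ≠ j`. Given the two
differences and the differentiated Guichard relation, these six equations reduce to the three
equations for `h₂`; curvatures enter through `κᵢⱼ = -βᵢⱼ/Hⱼ` with the rotation coefficients `βᵢⱼ`.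
Conversely, the dual factors satisfy the same six equations (`satisfiesCombescureEquations_dual`),
so a dual system exists on balls.

The relation with value `1` is algebra in the two differences. For existence, the prescribed
differential of `h₂` is closed (`closed_associatedForm`): this needs the first family of Lamé
equations and the Guichard relation with its derivatives, but not the second family. A Poincaré
lemma on simply connected domains then yields first `h₂` and afterwards the map itself. -/

open scoped ContDiff

namespace GuichardNet

open Set Filter Topology

/-! ### Partial derivatives, one-forms and the convex Poincaré lemma -/

section Calculus

variable {G : Type*} [NormedAddCommGroup G] [NormedSpace ℝ G] {U : Set R3} {x : R3}

theorem pderiv_congr (hU : IsOpen U) {g₁ g₂ : R3 → G} (h : EqOn g₁ g₂ U) (hx : x ∈ U) (i : Fin 3) :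
    pderiv i g₁ x = pderiv i g₂ x := by
  unfold pderiv
  rw [(h.eventuallyEq_of_mem (hU.mem_nhds hx)).fderiv_eq]

theorem contDiffOn_pderiv (hU : IsOpen U) {g : R3 → G} (hg : ContDiffOn ℝ ∞ g U) (i : Fin 3) :
    ContDiffOn ℝ ∞ (pderiv i g) U :=
  (hg.fderiv_of_isOpen hU (m := ∞) (by simp)).clm_apply contDiffOn_const

theorem differentiableAt_of_contDiffOn (hU : IsOpen U) {g : R3 → G} (hg : ContDiffOn ℝ ∞ g U)
    (hx : x ∈ U) : DifferentiableAt ℝ g x :=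
  (hg.contDiffAt (hU.mem_nhds hx)).differentiableAt (by simp)

theorem pderiv_comm (hU : IsOpen U) {g : R3 → G} (hg : ContDiffOn ℝ ∞ g U) (hx : x ∈ U)
    (i j : Fin 3) : pderiv i (pderiv j g) x = pderiv j (pderiv i g) x := by
  have hd : DifferentiableAt ℝ (fderiv ℝ g) x :=
    ((hg.fderiv_of_isOpen hU (m := ∞) (by simp)).contDiffAt (hU.mem_nhds hx)).differentiableAt
      (by simp)
  have key : ∀ k l : Fin 3, pderiv k (pderiv l g) x =
      fderiv ℝ (fderiv ℝ g) x (EuclideanSpace.single k 1) (EuclideanSpace.single l 1) := by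
    intro k l
    change fderiv ℝ (fun y => fderiv ℝ g y (EuclideanSpace.single l 1)) x _ = _
    rw [fderiv_clm_apply hd (differentiableAt_const _)]
    simp
  rw [key, key]
  exact ((hg.contDiffAt (hU.mem_nhds hx)).isSymmSndFDerivAt
    (by simpa using WithTop.coe_le_coe.2 (le_top : (2 : ℕ∞) ≤ ⊤))).eq _ _

theorem pderiv_mul {a b : R3 → ℝ} (ha : DifferentiableAt ℝ a x) (hb : DifferentiableAt ℝ b x)
    (i : Fin 3) : pderiv i (fun y => a y * b y) x = pderiv i a x * b x + a x * pderiv i b x := by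
  unfold pderiv
  rw [fderiv_fun_mul ha hb]
  simp
  ring

theorem pderiv_add {a b : R3 → G} (ha : DifferentiableAt ℝ a x) (hb : DifferentiableAt ℝ b x)
    (i : Fin 3) : pderiv i (fun y => a y + b y) x = pderiv i a x + pderiv i b x := by
  unfold pderiv
  rw [fderiv_fun_add ha hb]
  simp

theorem pderiv_sub {a b : R3 → G} (ha : DifferentiableAt ℝ a x) (hb : DifferentiableAt ℝ b x)
    (i : Fin 3) : pderiv i (fun y => a y - b y) x = pderiv i a x - pderiv i b x := by
  unfold pderiv
  rw [fderiv_fun_sub ha hb]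
  simp

theorem pderiv_smul {a : R3 → ℝ} {b : R3 → G} (ha : DifferentiableAt ℝ a x)
    (hb : DifferentiableAt ℝ b x) (i : Fin 3) :
    pderiv i (fun y => a y • b y) x = pderiv i a x • b x + a x • pderiv i b x := by
  unfold pderiv
  rw [fderiv_fun_smul ha hb]
  simp [add_comm]

theorem pderiv_const_smul (c : ℝ) {b : R3 → G} (hb : DifferentiableAt ℝ b x) (i : Fin 3) :
    pderiv i (fun y => c • b y) x = c • pderiv i b x := by
  unfold pderiv
  rw [fderiv_fun_const_smul hb]
  simp

theorem pderiv_const (c : G) (i : Fin 3) : pderiv i (fun _ : R3 => c) x = 0 := by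
  simp [pderiv]

theorem pderiv_inner {a b : R3 → R3} (ha : DifferentiableAt ℝ a x)
    (hb : DifferentiableAt ℝ b x) (i : Fin 3) :
    pderiv i (fun y => inner ℝ (a y) (b y)) x =
      inner ℝ (pderiv i a x) (b x) + inner ℝ (a x) (pderiv i b x) := by
  unfold pderiv
  rw [fderiv_inner_apply ℝ ha hb, add_comm]

theorem sum_smul_single (v : R3) : ∑ i, v i • EuclideanSpace.single i (1 : ℝ) = v := by
  ext j
  fin_cases j <;> simp [Fin.sum_univ_three]

/-- The `1`-form on `ℝ³` with the given coefficients. -/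
noncomputable def oneForm (θ : Fin 3 → R3 → G) (x : R3) : R3 →L[ℝ] G :=
  ∑ i, (EuclideanSpace.proj i : R3 →L[ℝ] ℝ).smulRight (θ i x)

theorem oneForm_apply (θ : Fin 3 → R3 → G) (x v : R3) : oneForm θ x v = ∑ i, v i • θ i x := by
  simp [oneForm]

theorem oneForm_single (θ : Fin 3 → R3 → G) (x : R3) (i : Fin 3) :
    oneForm θ x (EuclideanSpace.single i 1) = θ i x := by
  simp [oneForm_apply, PiLp.single_apply]

theorem contDiffOn_oneForm {θ : Fin 3 → R3 → G} (hθ : ∀ i, ContDiffOn ℝ ∞ (θ i) U) :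
    ContDiffOn ℝ ∞ (oneForm θ) U := by
  refine ContDiffOn.sum fun i _ => ?_
  exact contDiffOn_const.smulRight (hθ i)

/-- A primitive of a smooth `1`-form is smooth. -/
theorem contDiffOn_of_hasFDerivAt_oneForm (hU : IsOpen U) {θ : Fin 3 → R3 → G}
    (hθ : ∀ i, ContDiffOn ℝ ∞ (θ i) U) {g : R3 → G}
    (hg : ∀ x ∈ U, HasFDerivAt g (oneForm θ x) x) : ContDiffOn ℝ ∞ g U := by
  rw [contDiffOn_infty_iff_fderiv_of_isOpen hU]
  exact ⟨fun x hx => (hg x hx).differentiableAt.differentiableWithinAt,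
    (contDiffOn_oneForm hθ).congr fun x hx => (hg x hx).fderiv⟩

theorem pderiv_eq_of_hasFDerivAt_oneForm {θ : Fin 3 → R3 → G} {g : R3 → G}
    (hg : HasFDerivAt g (oneForm θ x) x) (i : Fin 3) : pderiv i g x = θ i x := by
  rw [pderiv, hg.fderiv, oneForm_single]

/-- The Poincaré lemma for closed `1`-forms on open convex sets. -/
theorem exists_primitive_of_convex [CompleteSpace G] {B : Set R3} (hB : IsOpen B)
    (hBc : Convex ℝ B) {θ : Fin 3 → R3 → G} (hθ : ∀ i, ContDiffOn ℝ ∞ (θ i) B)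
    (hclosed : ∀ x ∈ B, ∀ i j, pderiv j (θ i) x = pderiv i (θ j) x) :
    ∃ g : R3 → G, ∀ x ∈ B, HasFDerivAt g (oneForm θ x) x := by
  have hs := contDiffOn_oneForm hθ
  refine hBc.exists_forall_hasFDerivAt_of_fderiv_symmetric hB
    (hs.differentiableOn (by simp)) fun a ha v w => ?_
  have hd : ∀ i, DifferentiableAt ℝ (θ i) a := fun i =>
    differentiableAt_of_contDiffOn hB (hθ i) ha
  -- In coordinates, symmetry of the derivative of the form in `v` and `w` is symmetry of `∂ⱼθᵢ` in
  -- `i` and `j`.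
  have key : ∀ v w : R3, fderiv ℝ (oneForm θ) a v w = ∑ i, ∑ j, (v j * w i) • pderiv j (θ i) a := by
    intro v w
    have h1 : fderiv ℝ (fun y => oneForm θ y w) a v = fderiv ℝ (oneForm θ) a v w := by
      rw [fderiv_clm_apply (differentiableAt_of_contDiffOn hB hs ha) (differentiableAt_const _)]
      simp
    rw [← h1]
    simp only [oneForm_apply]
    rw [fderiv_fun_sum fun i _ => (hd i).fun_const_smul (w i)]
    simp only [sum_apply]
    refine Finset.sum_congr rfl fun i _ => ?_
    rw [fderiv_fun_const_smul (hd i)]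
    conv_lhs => rw [← sum_smul_single v]
    simp only [smul_apply, map_sum, map_smul, smul_smul, pderiv]
  rw [key, key, Finset.sum_comm]
  refine Finset.sum_congr rfl fun i _ => Finset.sum_congr rfl fun j _ => ?_
  rw [hclosed a ha, mul_comm]

end Calculus

/-! ### Gluing local primitives over simply connected domains -/

/-- On a simply connected, locally path connected space, local functions which differ by locally
constant ones can be glued, up to locally constant functions. -/
theorem exists_glue_of_simplyConnected {X : Type*} [TopologicalSpace X] [SimplyConnectedSpace X]
    [LocallyPathConnectedSpace X] {D : Type*} [AddCommGroup D] (B : X → Set X)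
    (hB : ∀ p, IsOpen (B p)) (hpB : ∀ p, p ∈ B p) (φ : X → X → D)
    (hφ : ∀ p q, ∀ x ∈ B p ∩ B q, ∀ᶠ y in 𝓝 x, φ p y - φ q y = φ p x - φ q x) (x₀ : X) (c : D) :
    ∃ g : X → D, g x₀ = c ∧ ∀ p, ∀ x ∈ B p, ∀ᶠ y in 𝓝 x, g y - φ p y = g x - φ p x := by
  let : TopologicalSpace D := ⊥
  have : DiscreteTopology D := ⟨rfl⟩
  -- The bundle with discrete fibre `D` whose transition functions are the differences `φ p - φ q`.
  -- Being locally constant, these are continuous, so the total space covers `X`; lifting the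
  -- identity of `X` gives a global section.
  let Z : FiberBundleCore X X D :=
    { baseSet := B
      isOpen_baseSet := hB
      indexAt := id
      mem_baseSet_at := hpB
      coordChange := fun p q x v => v + φ p x - φ q x
      coordChange_self := fun p x _ v => by simp
      continuousOn_coordChange := by
        rintro p q ⟨x, v⟩ ⟨hx, -⟩
        refine (continuousAt_const (y := v + φ p x - φ q x)).congr ?_ |>.continuousWithinAt
        rw [nhds_prod_eq]
        have hv : ∀ᶠ w in 𝓝 v, w = v := by simp [nhds_discrete]
        filter_upwards [(hφ p q x hx).prod_mk hv] with y hy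
        rw [hy.2, add_sub_assoc, add_sub_assoc, hy.1]
      coordChange_comp := fun p q r x _ v => by simp }
  have hcov : IsCoveringMap Z.proj := FiberBundle.isCoveringMap
  obtain ⟨s, ⟨hs0, hs⟩, -⟩ := hcov.existsUnique_continuousMap_lifts (ContinuousMap.id X) x₀
    (⟨x₀, c - φ x₀ x₀⟩ : Z.TotalSpace) rfl
  have hproj : ∀ x, (s x).1 = x := fun x => congrFun hs x
  let val : Z.TotalSpace → D := fun e => e.2
  have hval : ∀ p e, (Z.localTriv p e).2 = val e + φ e.1 e.1 - φ p e.1 := fun _ _ => rfl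
  -- The fibre over `x` carries the coordinate of chart `x`, hence the correction `φ x x`. In chart
  -- `p` the section reads `g - φ p`, which is locally constant by continuity into a discrete space.
  refine ⟨fun x => val (s x) + φ x x, ?_, fun p x hx => ?_⟩
  · change val (s x₀) + φ x₀ x₀ = c
    rw [hs0]
    exact sub_add_cancel c _
  have hc : ContinuousAt (fun y => (Z.localTriv p (s y)).2) x := by
    refine continuousAt_snd.comp
      (ContinuousAt.comp (g := Z.localTriv p) ?_ s.continuous.continuousAt)
    refine (Z.localTriv p).continuousAt ?_
    rw [Z.mem_localTriv_source, ← Z.baseSet_at, hproj]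
    exact hx
  have := hc.eventually_mem (s := {(Z.localTriv p (s x)).2}) (by simp [nhds_discrete])
  filter_upwards [this] with y hy
  rw [mem_singleton_iff, hval, hval, hproj, hproj] at hy
  exact hy

/-- The Poincaré lemma for closed `1`-forms on simply connected open subsets of `ℝ³`. -/
theorem exists_primitive_of_simplyConnected {G : Type*} [NormedAddCommGroup G] [NormedSpace ℝ G]
    [CompleteSpace G] {U : Set R3} (hU : IsOpen U) (hsc : IsSimplyConnected U)
    {θ : Fin 3 → R3 → G} (hθ : ∀ i, ContDiffOn ℝ ∞ (θ i) U)
    (hclosed : ∀ x ∈ U, ∀ i j, pderiv j (θ i) x = pderiv i (θ j) x) {p : R3} (hp : p ∈ U) (c : G) :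
    ∃ g : R3 → G, ContDiffOn ℝ ∞ g U ∧ (∀ x ∈ U, ∀ i, pderiv i g x = θ i x) ∧ g p = c := by
  classical
  have hball : ∀ x : U, ∃ r > 0, Metric.ball (x : R3) r ⊆ U := fun x =>
    Metric.isOpen_iff.1 hU x x.2
  choose r hr hrU using hball
  have hloc : ∀ x : U, ∃ g : R3 → G, ∀ y ∈ Metric.ball (x : R3) (r x),
      HasFDerivAt g (oneForm θ y) y := fun x =>
    exists_primitive_of_convex Metric.isOpen_ball (convex_ball _ _)
      (fun i => (hθ i).mono (hrU x)) (fun y hy => hclosed y (hrU x hy))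
  choose φ hφ using hloc
  have : SimplyConnectedSpace U := hsc
  have : LocallyPathConnectedSpace U := hU.locallyPathConnectedSpace
  let B : U → Set U := fun x => (↑) ⁻¹' Metric.ball (x : R3) (r x)
  have hcompat : ∀ a b : U, ∀ x ∈ B a ∩ B b,
      ∀ᶠ y : U in 𝓝 x, φ a y - φ b y = φ a x - φ b x := by
    rintro a b x hx
    -- The intersection of two balls is convex, hence connected, so two primitives differ by a
    -- constant on all of it.
    let S : Set R3 := Metric.ball (a : R3) (r a) ∩ Metric.ball (b : R3) (r b)
    have hxS : (x : R3) ∈ S := hx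
    have hconv : Convex ℝ S := (convex_ball (a : R3) (r a)).inter (convex_ball (b : R3) (r b))
    have hopen : IsOpen S := Metric.isOpen_ball.inter Metric.isOpen_ball
    have hd : ∀ y ∈ S, HasFDerivAt (fun z => φ a z - φ b z) 0 y := fun y hy =>
      ((hφ a y hy.1).fun_sub (hφ b y hy.2)).congr_fderiv (sub_self _)
    filter_upwards [continuous_subtype_val.continuousAt.preimage_mem_nhds
      (hopen.mem_nhds hxS)] with y hy
    exact hopen.is_const_of_fderiv_eq_zero (𝕜 := ℝ) (f := fun z => φ a z - φ b z)
      hconv.isPreconnected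
      (fun z hz => (hd z hz).differentiableAt.differentiableWithinAt)
      (fun z hz => (hd z hz).fderiv) hy hxS
  obtain ⟨g, hg0, hg⟩ := exists_glue_of_simplyConnected B
    (fun x => Metric.isOpen_ball.preimage continuous_subtype_val)
    (fun x => Metric.mem_ball_self (hr x)) (fun x y => φ x y) hcompat ⟨p, hp⟩ c
  let g' : R3 → G := fun x => if hx : x ∈ U then g ⟨x, hx⟩ else 0
  have hg' : ∀ x ∈ U, HasFDerivAt g' (oneForm θ x) x := by
    intro x hx
    have h1 := hg ⟨x, hx⟩ ⟨x, hx⟩ (Metric.mem_ball_self (hr _))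
    have h2 : ∀ᶠ y in 𝓝 x, g' y = φ ⟨x, hx⟩ y + (g ⟨x, hx⟩ - φ ⟨x, hx⟩ x) := by
      have h3 := (hU.isOpenEmbedding_subtypeVal.map_nhds_eq ⟨x, hx⟩).symm
      change ∀ᶠ y in 𝓝 ((⟨x, hx⟩ : U) : R3), _
      rw [h3, eventually_map]
      filter_upwards [h1] with y hy
      rw [← hy]
      simp [g']
    exact ((hφ ⟨x, hx⟩ x (Metric.mem_ball_self (hr _))).add_const _).congr_of_eventuallyEq h2
  exact ⟨g', contDiffOn_of_hasFDerivAt_oneForm hU hθ hg',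
    fun x hx i => pderiv_eq_of_hasFDerivAt_oneForm (hg' x hx) i, by simp [g', hp, hg0]⟩

/-! ### Cross products and the orthonormal frame of unit normals -/

theorem inner_eq_dotProduct (a b : R3) :
    inner ℝ a b = WithLp.ofLp a ⬝ᵥ WithLp.ofLp b := by
  rw [EuclideanSpace.inner_eq_star_dotProduct, star_trivial, dotProduct_comm]

/-- Cyclic invariance of the triple product: the Jacobian alone makes all three normals and Lamé
coefficients nonzero. -/
theorem inner_cross_cyclic (a : Fin 3 → R3) (i : Fin 3) :
    inner ℝ (a i) (cross (a (i + 1)) (a (i + 2))) =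
      Matrix.det (Matrix.of fun k j : Fin 3 => a j k) := by
  rw [inner_eq_dotProduct, Matrix.det_fin_three]
  fin_cases i <;>
    simp [cross, crossProduct, dotProduct, Fin.sum_univ_three] <;> ring

theorem cross_cross_eq (a b c : R3) :
    cross (cross a b) c = inner ℝ a c • b - inner ℝ b c • a := by
  simp only [inner_eq_dotProduct]
  ext k
  fin_cases k <;> simp [cross, crossProduct, dotProduct, Fin.sum_univ_three] <;> ring

theorem cross_cross_self_eq (c a : R3) :
    cross c (cross c a) = inner ℝ a c • c - inner ℝ c c • a := by
  simp only [inner_eq_dotProduct]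
  ext k
  fin_cases k <;> simp [cross, crossProduct, dotProduct, Fin.sum_univ_three] <;> ring

theorem cross_zero (c : R3) : cross c 0 = 0 := by
  simp [cross]

/-- A vector orthogonal to `b` and `c` is a multiple of `b × c`. -/
theorem inner_smul_cross_of_orthogonal {a b c : R3} (hb : inner ℝ b a = 0) (hc : inner ℝ c a = 0) :
    inner ℝ a (cross b c) • cross b c = inner ℝ (cross b c) (cross b c) • a := by
  -- Orthogonality gives `(b × c) × a = 0`, so the expansion of `(b × c) × ((b × c) × a)` vanishes.
  have h := cross_cross_self_eq (cross b c) a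
  rw [cross_cross_eq b c a, hb, hc, zero_smul, zero_smul, sub_zero, cross_zero] at h
  exact (sub_eq_zero.1 h.symm)

theorem contDiffOn_cross {U : Set R3} {a b : R3 → R3} (ha : ContDiffOn ℝ ∞ a U)
    (hb : ContDiffOn ℝ ∞ b U) : ContDiffOn ℝ ∞ (fun x => cross (a x) (b x)) U := by
  rw [contDiffOn_euclidean] at ha hb ⊢
  intro i
  fin_cases i <;> simp only [cross, crossProduct, LinearMap.mk₂_apply] <;>
  · simp
    fun_prop

namespace IsTriplyOrthogonalSystem

variable {U : Set R3} {f : R3 → R3} (hf : IsTriplyOrthogonalSystem U f) {x : R3}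

include hf

theorem cross_ne_zero (hx : x ∈ U) (i : Fin 3) :
    cross (pderiv (i + 1) f x) (pderiv (i + 2) f x) ≠ 0 := by
  intro h
  have h1 := inner_cross_cyclic (fun j => pderiv j f x) i
  rw [h, inner_zero_right] at h1
  exact hf.jacobian_ne_zero x hx h1.symm

theorem contDiffOn_unitNormal (i : Fin 3) : ContDiffOn ℝ ∞ (unitNormal f i) U := by
  have h := contDiffOn_cross (contDiffOn_pderiv hf.isOpen hf.smooth (i + 1))
    (contDiffOn_pderiv hf.isOpen hf.smooth (i + 2))
  exact ((h.norm ℝ fun x hx => hf.cross_ne_zero hx i).inv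
    fun x hx => norm_ne_zero_iff.2 (hf.cross_ne_zero hx i)).smul h

theorem contDiffOn_lame (i : Fin 3) : ContDiffOn ℝ ∞ (lame f i) U :=
  (contDiffOn_pderiv hf.isOpen hf.smooth i).inner ℝ (hf.contDiffOn_unitNormal i)

theorem lame_ne_zero (hx : x ∈ U) (i : Fin 3) : lame f i x ≠ 0 := by
  rw [lame, unitNormal, inner_smul_right]
  refine mul_ne_zero (inv_ne_zero (norm_ne_zero_iff.2 (hf.cross_ne_zero hx i))) ?_
  rw [inner_cross_cyclic fun j => pderiv j f x]
  exact hf.jacobian_ne_zero x hx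

theorem pderiv_eq (hx : x ∈ U) (i : Fin 3) :
    pderiv i f x = lame f i x • unitNormal f i x := by
  have hn := norm_ne_zero_iff.2 (hf.cross_ne_zero hx i)
  have h := inner_smul_cross_of_orthogonal (hf.orthogonal x hx (i + 1) i (by simp))
    (hf.orthogonal x hx (i + 2) i (by simp))
  rw [lame, unitNormal, inner_smul_right, smul_smul, mul_right_comm, mul_smul, h, smul_smul,
    real_inner_self_eq_norm_sq]
  field_simp
  simp

theorem norm_unitNormal (hx : x ∈ U) (i : Fin 3) : ‖unitNormal f i x‖ = 1 := by
  rw [unitNormal, norm_smul, norm_inv, norm_norm,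
    inv_mul_cancel₀ (norm_ne_zero_iff.2 (hf.cross_ne_zero hx i))]

theorem inner_unitNormal_self (hx : x ∈ U) (i : Fin 3) :
    inner ℝ (unitNormal f i x) (unitNormal f i x) = 1 := by
  rw [real_inner_self_eq_norm_sq, hf.norm_unitNormal hx, one_pow]

theorem inner_unitNormal (hx : x ∈ U) {i j : Fin 3} (hij : i ≠ j) :
    inner ℝ (unitNormal f i x) (unitNormal f j x) = 0 := by
  have h := hf.orthogonal x hx i j hij
  rw [hf.pderiv_eq hx, hf.pderiv_eq hx, inner_smul_left, inner_smul_right] at h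
  simpa [hf.lame_ne_zero hx] using h

theorem eq_of_inner_unitNormal (hx : x ∈ U) {v w : R3}
    (h : ∀ k, inner ℝ v (unitNormal f k x) = inner ℝ w (unitNormal f k x)) : v = w := by
  have ho : Orthonormal ℝ fun k => unitNormal f k x :=
    ⟨fun i => hf.norm_unitNormal hx i, fun i j hij => hf.inner_unitNormal hx hij⟩
  refine InnerProductSpace.ext_inner_right_basis (𝕜 := ℝ)
    (basisOfOrthonormalOfCardEqFinrank ho (by simp)) fun k => ?_
  rw [coe_basisOfOrthonormalOfCardEqFinrank]
  exact h k

end IsTriplyOrthogonalSystem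

/-! ### Rotation coefficients, Lamé equations and Combescure transforms -/

/-- The rotation coefficient `βᵢⱼ = ∂ᵢ Hⱼ / Hᵢ`. -/
noncomputable def rotationCoeff (f : R3 → R3) (i j : Fin 3) (x : R3) : ℝ :=
  pderiv i (lame f j) x / lame f i x

/-- The compatibility conditions `∂ⱼ hᵢ = (hⱼ - hᵢ) ∂ⱼ Hᵢ / Hᵢ` for the factors of a Combescure
transform. -/
def SatisfiesCombescureEquations (U : Set R3) (f : R3 → R3) (h : Fin 3 → R3 → ℝ) : Prop :=
  ∀ x ∈ U, ∀ i j : Fin 3, i ≠ j →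
    lame f i x * pderiv j (h i) x = (h j x - h i x) * pderiv j (lame f i) x

namespace IsTriplyOrthogonalSystem

variable {U : Set R3} {f : R3 → R3} (hf : IsTriplyOrthogonalSystem U f) {x : R3}

include hf

theorem pderiv_lame (hx : x ∈ U) (i j : Fin 3) :
    pderiv i (lame f j) x = lame f i x * rotationCoeff f i j x := by
  rw [rotationCoeff, mul_div_cancel₀ _ (hf.lame_ne_zero hx i)]

theorem contDiffOn_rotationCoeff (i j : Fin 3) : ContDiffOn ℝ ∞ (rotationCoeff f i j) U :=
  (contDiffOn_pderiv hf.isOpen (hf.contDiffOn_lame j) i).div (hf.contDiffOn_lame i)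
    fun _ hx => hf.lame_ne_zero hx i

theorem differentiableAt_lame (hx : x ∈ U) (i : Fin 3) : DifferentiableAt ℝ (lame f i) x :=
  differentiableAt_of_contDiffOn hf.isOpen (hf.contDiffOn_lame i) hx

theorem differentiableAt_unitNormal (hx : x ∈ U) (i : Fin 3) :
    DifferentiableAt ℝ (unitNormal f i) x :=
  differentiableAt_of_contDiffOn hf.isOpen (hf.contDiffOn_unitNormal i) hx

theorem differentiableAt_rotationCoeff (hx : x ∈ U) (i j : Fin 3) :
    DifferentiableAt ℝ (rotationCoeff f i j) x :=
  differentiableAt_of_contDiffOn hf.isOpen (hf.contDiffOn_rotationCoeff i j) hx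

theorem inner_pderiv_unitNormal_antisymm (hx : x ∈ U) (i j k : Fin 3) :
    inner ℝ (pderiv j (unitNormal f i) x) (unitNormal f k x) =
      -inner ℝ (pderiv j (unitNormal f k) x) (unitNormal f i x) := by
  have h : pderiv j (fun y => inner ℝ (unitNormal f i y) (unitNormal f k y)) x = 0 := by
    have hc : EqOn (fun y => inner ℝ (unitNormal f i y) (unitNormal f k y))
        (fun _ => if i = k then (1 : ℝ) else 0) U := by
      intro y hy
      dsimp only
      split_ifs with hik
      · rw [hik, hf.inner_unitNormal_self hy]
      · exact hf.inner_unitNormal hy hik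
    rw [pderiv_congr hf.isOpen hc hx, pderiv_const]
  rw [pderiv_inner (hf.differentiableAt_unitNormal hx i) (hf.differentiableAt_unitNormal hx k),
    real_inner_comm (pderiv j (unitNormal f k) x)] at h
  linarith

theorem inner_pderiv_unitNormal_self (hx : x ∈ U) (i j : Fin 3) :
    inner ℝ (pderiv j (unitNormal f i) x) (unitNormal f i x) = 0 := by
  have := hf.inner_pderiv_unitNormal_antisymm hx i j i
  linarith

theorem pderiv_pderiv_eq (hx : x ∈ U) (i j : Fin 3) :
    pderiv j (pderiv i f) x = pderiv j (lame f i) x • unitNormal f i x +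
      lame f i x • pderiv j (unitNormal f i) x := by
  rw [pderiv_congr hf.isOpen (fun y hy => hf.pderiv_eq hy i) hx,
    pderiv_smul (hf.differentiableAt_lame hx i) (hf.differentiableAt_unitNormal hx i)]

theorem inner_pderiv_unitNormal_comm (hx : x ∈ U) {i j k : Fin 3} (hki : k ≠ i) (hkj : k ≠ j) :
    lame f i x * inner ℝ (pderiv j (unitNormal f i) x) (unitNormal f k x) =
      lame f j x * inner ℝ (pderiv i (unitNormal f j) x) (unitNormal f k x) := by
  have h := pderiv_comm hf.isOpen hf.smooth hx i j
  rw [hf.pderiv_pderiv_eq hx, hf.pderiv_pderiv_eq hx] at h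
  have h' := congrArg (fun v => inner ℝ v (unitNormal f k x)) h
  simp only [inner_add_left, real_inner_smul_left, hf.inner_unitNormal hx hki.symm,
    hf.inner_unitNormal hx hkj.symm, mul_zero, zero_add] at h'
  exact h'.symm

/-- Dupin's theorem: the coordinate lines are curvature lines. -/
theorem inner_pderiv_unitNormal_eq_zero (hx : x ∈ U) {i j k : Fin 3} (hij : i ≠ j) (hki : k ≠ i)
    (hkj : k ≠ j) : inner ℝ (pderiv j (unitNormal f i) x) (unitNormal f k x) = 0 := by
  -- Symmetry of mixed partials together with antisymmetry of the frame gives `Hᵢa = -Hⱼb`, `Hₖb =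
  -- -Hᵢc`, `Hⱼc = -Hₖa`. Going round this cycle changes the sign of `a` three times, so `a = 0`.
  have h1 := hf.inner_pderiv_unitNormal_comm hx hki hkj
  have h2 := hf.inner_pderiv_unitNormal_comm hx (i := k) (j := i) (k := j) hkj.symm hij.symm
  have h3 := hf.inner_pderiv_unitNormal_comm hx (i := j) (j := k) (k := i) hij hki.symm
  rw [hf.inner_pderiv_unitNormal_antisymm hx j i k] at h1
  rw [hf.inner_pderiv_unitNormal_antisymm hx i k j] at h2
  rw [hf.inner_pderiv_unitNormal_antisymm hx k j i] at h3
  set a := inner ℝ (pderiv j (unitNormal f i) x) (unitNormal f k x)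
  set b := inner ℝ (pderiv i (unitNormal f k) x) (unitNormal f j x)
  set c := inner ℝ (pderiv k (unitNormal f j) x) (unitNormal f i x)
  have hi := hf.lame_ne_zero hx i
  have hk := hf.lame_ne_zero hx k
  have : (2 * lame f i x * lame f k x) * a = 0 := by
    linear_combination lame f k x * h1 - lame f j x * h2 + lame f i x * h3
  simpa [hi, hk] using this

/-- The component along `Nᵢ` vanishes by unit length and the third one by Dupin's theorem; the one
along `Nⱼ` is read off from `∂ⱼ∂ᵢf = ∂ᵢ∂ⱼf`. -/
theorem pderiv_unitNormal (hx : x ∈ U) {i j : Fin 3} (hij : i ≠ j) :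
    pderiv j (unitNormal f i) x = rotationCoeff f i j x • unitNormal f j x := by
  refine hf.eq_of_inner_unitNormal hx fun k => ?_
  rw [real_inner_smul_left]
  by_cases hki : k = i
  · rw [hki, hf.inner_pderiv_unitNormal_self hx, hf.inner_unitNormal hx hij.symm, mul_zero]
  by_cases hkj : k = j
  · rw [hkj, hf.inner_unitNormal_self hx, mul_one]
    have h := pderiv_comm hf.isOpen hf.smooth hx i j
    rw [hf.pderiv_pderiv_eq hx, hf.pderiv_pderiv_eq hx] at h
    have h' := congrArg (fun v => inner ℝ v (unitNormal f j x)) h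
    simp only [inner_add_left, real_inner_smul_left, hf.inner_unitNormal hx hij,
      hf.inner_unitNormal_self hx, hf.inner_pderiv_unitNormal_self hx] at h'
    rw [rotationCoeff, eq_div_iff (hf.lame_ne_zero hx i)]
    linarith
  · rw [hf.inner_pderiv_unitNormal_eq_zero hx hij hki hkj,
      hf.inner_unitNormal hx (Ne.symm hkj), mul_zero]

theorem principalCurvature_eq (hx : x ∈ U) {i j : Fin 3} (hij : i ≠ j) :
    principalCurvature f i j x = -rotationCoeff f i j x / lame f j x := by
  have hj := hf.lame_ne_zero hx j
  rw [principalCurvature, hf.pderiv_pderiv_eq hx, hf.pderiv_eq hx]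
  simp only [inner_add_left, real_inner_smul_left, real_inner_smul_right,
    hf.inner_unitNormal hx hij.symm, hf.inner_unitNormal_self hx]
  rw [hf.inner_pderiv_unitNormal_antisymm hx, hf.pderiv_unitNormal hx hij, real_inner_smul_left,
    hf.inner_unitNormal_self hx]
  field_simp
  ring

/-- The first family of the Lamé equations. -/
theorem pderiv_rotationCoeff (hx : x ∈ U) {i j k : Fin 3} (hij : i ≠ j) (hik : i ≠ k)
    (hjk : j ≠ k) :
    pderiv k (rotationCoeff f i j) x = rotationCoeff f i k x * rotationCoeff f k j x := by
  have key : ∀ {j k : Fin 3}, i ≠ j → pderiv k (pderiv j (unitNormal f i)) x =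
      pderiv k (rotationCoeff f i j) x • unitNormal f j x +
        rotationCoeff f i j x • pderiv k (unitNormal f j) x := fun {j k} hij => by
    rw [pderiv_congr hf.isOpen (fun y hy => hf.pderiv_unitNormal hy hij) hx,
      pderiv_smul (hf.differentiableAt_rotationCoeff hx i j) (hf.differentiableAt_unitNormal hx j)]
  -- The equation is the `Nⱼ`-component of the symmetry of mixed partials of `Nᵢ`.
  have h := pderiv_comm hf.isOpen (hf.contDiffOn_unitNormal i) hx k j
  rw [key hij, key hik, hf.pderiv_unitNormal hx hjk, hf.pderiv_unitNormal hx hjk.symm] at h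
  have h' := congrArg (fun v => inner ℝ v (unitNormal f j x)) h
  simpa only [inner_add_left, real_inner_smul_left, hf.inner_unitNormal hx hjk.symm,
    hf.inner_unitNormal_self hx, mul_zero, mul_one, add_zero, zero_add] using h'

/-- Only `Nᵢ` and `Nⱼ` occur, so closedness of a Combescure form amounts to two scalar equations for
each pair of indices. -/
theorem pderiv_smul_pderiv (hx : x ∈ U) {a : R3 → ℝ} (ha : DifferentiableAt ℝ a x) {i j : Fin 3}
    (hij : i ≠ j) :
    pderiv j (fun y => a y • pderiv i f y) x =
      (lame f i x * pderiv j a x + a x * pderiv j (lame f i) x) • unitNormal f i x +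
        (a x * pderiv i (lame f j) x) • unitNormal f j x := by
  rw [pderiv_smul ha (differentiableAt_of_contDiffOn hf.isOpen
    (contDiffOn_pderiv hf.isOpen hf.smooth i) hx), hf.pderiv_pderiv_eq hx, hf.pderiv_eq hx,
    hf.pderiv_unitNormal hx hij, hf.pderiv_lame hx i j]
  module

/-- Smoothness of the factors is not part of the definition of a Combescure transform; it follows
from `hᵢ = ⟨∂ᵢg, Nᵢ⟩ / Hᵢ`. -/
theorem contDiffOn_factor {h : Fin 3 → R3 → ℝ} {g : R3 → R3} (hg : IsCombescureTransform U f h g)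
    (i : Fin 3) : ContDiffOn ℝ ∞ (h i) U := by
  refine (((contDiffOn_pderiv hf.isOpen hg.1 i).inner ℝ (hf.contDiffOn_unitNormal i)).div
    (hf.contDiffOn_lame i) fun x hx => hf.lame_ne_zero hx i).congr fun x hx => ?_
  rw [Pi.div_apply, eq_div_iff (hf.lame_ne_zero hx i), hg.2 x hx i, real_inner_smul_left]
  rfl

theorem factor_unique {h h' : Fin 3 → R3 → ℝ} {g : R3 → R3} (hg : IsCombescureTransform U f h g)
    (hg' : IsCombescureTransform U f h' g) (hx : x ∈ U) (i : Fin 3) : h i x = h' i x := by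
  have h1 := (hg.2 x hx i).symm.trans (hg'.2 x hx i)
  have h2 := congrArg (fun v => inner ℝ v (unitNormal f i x)) h1
  simp only [real_inner_smul_left] at h2
  exact mul_right_cancel₀ (hf.lame_ne_zero hx i) h2

theorem satisfiesCombescureEquations {h : Fin 3 → R3 → ℝ} {g : R3 → R3}
    (hg : IsCombescureTransform U f h g) : SatisfiesCombescureEquations U f h := by
  intro x hx i j hij
  have hd : ∀ i, DifferentiableAt ℝ (h i) x := fun i =>
    differentiableAt_of_contDiffOn hf.isOpen (hf.contDiffOn_factor hg i) hx
  have hc := pderiv_comm hf.isOpen hg.1 hx j i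
  rw [pderiv_congr hf.isOpen (fun y hy => hg.2 y hy i) hx,
    pderiv_congr hf.isOpen (fun y hy => hg.2 y hy j) hx,
    hf.pderiv_smul_pderiv hx (hd i) hij, hf.pderiv_smul_pderiv hx (hd j) hij.symm] at hc
  have h' := congrArg (fun v => inner ℝ v (unitNormal f i x)) hc
  simp only [inner_add_left, real_inner_smul_left, hf.inner_unitNormal hx hij.symm,
    hf.inner_unitNormal_self hx] at h'
  linarith

theorem closed_of_satisfiesCombescureEquations {h : Fin 3 → R3 → ℝ}
    (hs : ∀ i, ContDiffOn ℝ ∞ (h i) U) (he : SatisfiesCombescureEquations U f h)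
    (hx : x ∈ U) (i j : Fin 3) :
    pderiv j (fun y => h i y • pderiv i f y) x = pderiv i (fun y => h j y • pderiv j f y) x := by
  rcases eq_or_ne i j with rfl | hij
  · rfl
  have hd : ∀ i, DifferentiableAt ℝ (h i) x := fun i =>
    differentiableAt_of_contDiffOn hf.isOpen (hs i) hx
  rw [hf.pderiv_smul_pderiv hx (hd i) hij, hf.pderiv_smul_pderiv hx (hd j) hij.symm,
    he x hx i j hij, he x hx j i hij.symm]
  module

theorem exists_combescureTransform_ball {h : Fin 3 → R3 → ℝ} {c : R3} {r : ℝ}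
    (hB : Metric.ball c r ⊆ U) (hs : ∀ i, ContDiffOn ℝ ∞ (h i) U)
    (he : SatisfiesCombescureEquations U f h) :
    ∃ g, IsCombescureTransform (Metric.ball c r) f h g := by
  have hθ : ∀ i, ContDiffOn ℝ ∞ (fun y => h i y • pderiv i f y) (Metric.ball c r) := fun i =>
    ((hs i).smul (contDiffOn_pderiv hf.isOpen hf.smooth i)).mono hB
  obtain ⟨g, hg⟩ := exists_primitive_of_convex Metric.isOpen_ball (convex_ball c r) hθ
    fun x hx i j => hf.closed_of_satisfiesCombescureEquations hs he (hB hx) i j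
  exact ⟨g, contDiffOn_of_hasFDerivAt_oneForm Metric.isOpen_ball hθ hg,
    fun x hx i => pderiv_eq_of_hasFDerivAt_oneForm (hg x hx) i⟩

theorem exists_combescureTransform {h : Fin 3 → R3 → ℝ} (hsc : IsSimplyConnected U)
    (hs : ∀ i, ContDiffOn ℝ ∞ (h i) U) (he : SatisfiesCombescureEquations U f h) {p : R3}
    (hp : p ∈ U) (q : R3) : ∃ g, IsCombescureTransform U f h g ∧ g p = q := by
  obtain ⟨g, hg, hg', hgp⟩ := exists_primitive_of_simplyConnected hf.isOpen hsc
    (fun i => (hs i).smul (contDiffOn_pderiv hf.isOpen hf.smooth i))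
    (fun x hx i j => hf.closed_of_satisfiesCombescureEquations hs he hx i j)
    hp q
  exact ⟨g, ⟨hg, hg'⟩, hgp⟩

end IsTriplyOrthogonalSystem

theorem IsCombescureTransform.const_smul {U : Set R3} (hU : IsOpen U) {f g : R3 → R3}
    {h : Fin 3 → R3 → ℝ} (hg : IsCombescureTransform U f h g) (c : ℝ) :
    IsCombescureTransform U f (fun i x => c * h i x) (fun x => c • g x) := by
  refine ⟨hg.1.const_smul c, fun x hx i => ?_⟩
  rw [pderiv_const_smul c (differentiableAt_of_contDiffOn hU hg.1 hx), hg.2 x hx i, smul_smul]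

/-! ### Pointwise algebra of the factors -/

section Algebra

variable {H0 H1 H2 h0 h1 h2 d0 d1 d2 e0 e1 e2 : ℝ}

/-- In this and the next four lemmas `d` and `e` stand for the derivatives of `H` and `h` in one
fixed direction: `hd` is the differentiated Guichard relation, `hdu` and `hdv` are the
differentiated difference relations `hu` and `hv`. -/
theorem factor_deriv_third_of_first (n0 : H0 ≠ 0) (hG : H0 ^ 2 + H1 ^ 2 = H2 ^ 2)
    (hu : H0 * H2 * (h0 - h2) = H1) (hd : H0 * d0 + H1 * d1 = H2 * d2)
    (hdu : (d0 * H2 + H0 * d2) * (h0 - h2) + H0 * H2 * (e0 - e2) = d1)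
    (h : H0 * e0 = (h2 - h0) * d0) : e2 * H2 ^ 3 = H1 * d0 - H0 * d1 := by
  refine mul_left_cancel₀ n0 ?_
  linear_combination -H2 ^ 2 * hdu + H2 ^ 3 * h + H2 * d2 * hu - H1 * hd + d1 * hG

theorem factor_deriv_first_of_third (n2 : H2 ≠ 0) (hG : H0 ^ 2 + H1 ^ 2 = H2 ^ 2)
    (hu : H0 * H2 * (h0 - h2) = H1) (hd : H0 * d0 + H1 * d1 = H2 * d2)
    (hdu : (d0 * H2 + H0 * d2) * (h0 - h2) + H0 * H2 * (e0 - e2) = d1)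
    (h : e2 * H2 ^ 3 = H1 * d0 - H0 * d1) : H0 * e0 = (h2 - h0) * d0 := by
  grind

theorem factor_deriv_second_of_third (n2 : H2 ≠ 0) (hG : H0 ^ 2 + H1 ^ 2 = H2 ^ 2)
    (hv : H1 * H2 * (h1 - h2) = -H0) (hd : H0 * d0 + H1 * d1 = H2 * d2)
    (hdv : (d1 * H2 + H1 * d2) * (h1 - h2) + H1 * H2 * (e1 - e2) = -d0)
    (h : e2 * H2 ^ 3 = H1 * d0 - H0 * d1) : H1 * e1 = (h2 - h1) * d1 := by
  grind

theorem factor_deriv_first_second (n1 : H1 ≠ 0) (n2 : H2 ≠ 0)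
    (hG : H0 ^ 2 + H1 ^ 2 = H2 ^ 2) (hu : H0 * H2 * (h0 - h2) = H1)
    (hv : H1 * H2 * (h1 - h2) = -H0) (hd : H0 * d0 + H1 * d1 = H2 * d2)
    (hdu : (d0 * H2 + H0 * d2) * (h0 - h2) + H0 * H2 * (e0 - e2) = d1)
    (h : H2 * e2 = (h1 - h2) * d2) : H0 * e0 = (h1 - h0) * d0 := by
  grind

theorem factor_deriv_second_first (n1 : H1 ≠ 0) (n2 : H2 ≠ 0)
    (hG : H0 ^ 2 + H1 ^ 2 = H2 ^ 2) (hu : H0 * H2 * (h0 - h2) = H1)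
    (hv : H1 * H2 * (h1 - h2) = -H0) (hd : H0 * d0 + H1 * d1 = H2 * d2)
    (hdv : (d1 * H2 + H1 * d2) * (h1 - h2) + H1 * H2 * (e1 - e2) = -d0)
    (h : H2 * e2 = (h0 - h2) * d2) : H1 * e1 = (h0 - h1) * d1 := by
  grind

theorem factor_differences_of_squares (n0 : H0 ≠ 0) (n1 : H1 ≠ 0) (n2 : H2 ≠ 0)
    (hG : H0 ^ 2 + H1 ^ 2 = H2 ^ 2) (ha : 1 / H0 ^ 2 + 1 / H1 ^ 2 = (h0 - h1) ^ 2)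
    (hb : 1 / H0 ^ 2 - 1 / H2 ^ 2 = (h0 - h2) ^ 2)
    (hc : 1 / H1 ^ 2 - 1 / H2 ^ 2 = (h1 - h2) ^ 2) :
    (H0 * H2 * (h0 - h2) = H1 ∧ H1 * H2 * (h1 - h2) = -H0) ∨
      (H0 * H2 * (h0 - h2) = -H1 ∧ H1 * H2 * (h1 - h2) = H0) := by
  field_simp at ha hb hc
  have hu : (H0 * H2 * (h0 - h2)) ^ 2 = H1 ^ 2 := by linear_combination -hb - hG
  have hv : (H1 * H2 * (h1 - h2)) ^ 2 = H0 ^ 2 := by linear_combination -hc - hG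
  -- The first two equations leave four sign choices. This third one excludes equal signs, for which
  -- the left side would be `(H1² - H0²)²`, off by `4 H0² H1²`.
  have hw : (H1 * (H0 * H2 * (h0 - h2)) - H0 * (H1 * H2 * (h1 - h2))) ^ 2 =
      (H0 ^ 2 + H1 ^ 2) ^ 2 := by
    linear_combination (-H2 ^ 2) * ha - (H0 ^ 2 + H1 ^ 2) * hG
  have hne : 4 * (H0 * H1) ^ 2 ≠ 0 := by positivity
  rcases sq_eq_sq_iff_eq_or_eq_neg.1 hu with h | h <;>
    rcases sq_eq_sq_iff_eq_or_eq_neg.1 hv with h' | h'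
  · rw [h, h'] at hw
    exact absurd (by linear_combination -hw) hne
  · exact Or.inl ⟨h, h'⟩
  · exact Or.inr ⟨h, h'⟩
  · rw [h, h'] at hw
    exact absurd (by linear_combination -hw) hne

end Algebra

/-! ### Compatibility conditions versus the system for `h₂` -/

namespace IsGuichardNet

variable {U : Set R3} {f : R3 → R3} (hf : IsGuichardNet U f) {x : R3}

include hf

theorem sq_add_sq (hx : x ∈ U) : lame f 0 x ^ 2 + lame f 1 x ^ 2 = lame f 2 x ^ 2 := by
  linarith [hf.2 x hx]

theorem lame_mul_pderiv (hx : x ∈ U) (i : Fin 3) :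
    lame f 0 x * pderiv i (lame f 0) x + lame f 1 x * pderiv i (lame f 1) x =
      lame f 2 x * pderiv i (lame f 2) x := by
  have hd := fun j => hf.1.differentiableAt_lame hx j
  have hc : EqOn (fun y => lame f 0 y * lame f 0 y + lame f 1 y * lame f 1 y)
      (fun y => lame f 2 y * lame f 2 y) U := fun y hy => by
    dsimp only
    linear_combination hf.sq_add_sq hy
  have h := pderiv_congr hf.1.isOpen hc hx i
  rw [pderiv_add ((hd 0).fun_mul (hd 0)) ((hd 1).fun_mul (hd 1)), pderiv_mul (hd 0) (hd 0),
    pderiv_mul (hd 1) (hd 1), pderiv_mul (hd 2) (hd 2)] at h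
  linarith

/-- The constant `c` lets one statement serve both difference relations, with `c = 1` and `c = -1`.
-/
theorem pderiv_mul_mul_factor_sub {h : Fin 3 → R3 → ℝ} {c : ℝ} {k l : Fin 3}
    (hs : ∀ i, ContDiffOn ℝ ∞ (h i) U)
    (he : ∀ y ∈ U, lame f k y * lame f 2 y * (h k y - h 2 y) = c * lame f l y)
    (hx : x ∈ U) (i : Fin 3) :
    (pderiv i (lame f k) x * lame f 2 x + lame f k x * pderiv i (lame f 2) x) * (h k x - h 2 x) +
      lame f k x * lame f 2 x * (pderiv i (h k) x - pderiv i (h 2) x) =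
        c * pderiv i (lame f l) x := by
  have hd := fun j => hf.1.differentiableAt_lame hx j
  have hd' := fun j => differentiableAt_of_contDiffOn hf.1.isOpen (hs j) hx
  have h := pderiv_congr hf.1.isOpen he hx i
  rwa [pderiv_mul ((hd k).fun_mul (hd 2)) ((hd' k).fun_sub (hd' 2)), pderiv_mul (hd k) (hd 2),
    pderiv_sub (hd' k) (hd' 2), pderiv_mul (differentiableAt_const c) (hd l), pderiv_const,
    zero_mul, zero_add] at h

theorem fst_iff {h : Fin 3 → R3 → ℝ} (hx : x ∈ U) :
    h 0 x = h 2 x + lame f 1 x / (lame f 0 x * lame f 2 x) ↔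
      lame f 0 x * lame f 2 x * (h 0 x - h 2 x) = 1 * lame f 1 x := by
  have h0 := hf.1.lame_ne_zero hx 0
  have h2 := hf.1.lame_ne_zero hx 2
  rw [← sub_eq_iff_eq_add', eq_div_iff (mul_ne_zero h0 h2), one_mul, mul_comm]

theorem snd_iff {h : Fin 3 → R3 → ℝ} (hx : x ∈ U) :
    h 1 x = h 2 x - lame f 0 x / (lame f 1 x * lame f 2 x) ↔
      lame f 1 x * lame f 2 x * (h 1 x - h 2 x) = -1 * lame f 0 x := by
  have h1 := hf.1.lame_ne_zero hx 1
  have h2 := hf.1.lame_ne_zero hx 2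
  rw [sub_eq_add_neg, ← sub_eq_iff_eq_add', ← neg_div, eq_div_iff (mul_ne_zero h1 h2), mul_comm,
    neg_one_mul]

/-- The `x`- and `y`-equations are the compatibility conditions for `∂₀h₂` and `∂₁h₂`. No such
condition governs `∂₂h₂`; it comes from the one for `∂₂h₀` and the differentiated difference `h₀ -
h₂`. -/
theorem solvesAssociatedEquations_of {h : Fin 3 → R3 → ℝ} (hs : ∀ i, ContDiffOn ℝ ∞ (h i) U)
    (he : SatisfiesCombescureEquations U f h)
    (hu : ∀ x ∈ U, lame f 0 x * lame f 2 x * (h 0 x - h 2 x) = 1 * lame f 1 x)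
    (hv : ∀ x ∈ U, lame f 1 x * lame f 2 x * (h 1 x - h 2 x) = -1 * lame f 0 x) :
    SolvesAssociatedEquations U f h := by
  refine ⟨hs, fun x hx => ?_, fun x hx => ?_, fun x hx => ?_,
    fun x hx => (hf.fst_iff hx).2 (hu x hx), fun x hx => (hf.snd_iff hx).2 (hv x hx)⟩
  all_goals
    have n0 := hf.1.lame_ne_zero hx 0
    have n1 := hf.1.lame_ne_zero hx 1
    have n2 := hf.1.lame_ne_zero hx 2
  · rw [hf.1.principalCurvature_eq hx (by decide), rotationCoeff]
    have h1 := he x hx 2 0 (by decide)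
    have h2 := hu x hx
    field_simp
    refine mul_left_cancel₀ n0 ?_
    linear_combination lame f 0 x ^ 2 * lame f 2 x * h1 + lame f 0 x * pderiv 0 (lame f 2) x * h2
  · rw [hf.1.principalCurvature_eq hx (by decide), rotationCoeff]
    have h1 := he x hx 2 1 (by decide)
    have h2 := hv x hx
    field_simp
    refine mul_left_cancel₀ n1 ?_
    linear_combination lame f 1 x ^ 2 * lame f 2 x * h1 + lame f 1 x * pderiv 1 (lame f 2) x * h2
  · rw [hf.1.principalCurvature_eq hx (by decide), hf.1.principalCurvature_eq hx (by decide),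
      rotationCoeff, rotationCoeff]
    have h1 := factor_deriv_third_of_first n0 (hf.sq_add_sq hx) (by simpa using hu x hx)
      (hf.lame_mul_pderiv hx 2) (by simpa using hf.pderiv_mul_mul_factor_sub hs hu hx 2)
      (he x hx 0 2 (by decide))
    field_simp
    linear_combination h1

theorem satisfiesCombescureEquations_of_solves {h : Fin 3 → R3 → ℝ}
    (hh : SolvesAssociatedEquations U f h) : SatisfiesCombescureEquations U f h := by
  have hu := fun x hx => (hf.fst_iff hx).1 (hh.fst x hx)
  have hv := fun x hx => (hf.snd_iff hx).1 (hh.snd x hx)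
  intro x hx
  have n0 := hf.1.lame_ne_zero hx 0
  have n1 := hf.1.lame_ne_zero hx 1
  have n2 := hf.1.lame_ne_zero hx 2
  have hG := hf.sq_add_sq hx
  have hux : lame f 0 x * lame f 2 x * (h 0 x - h 2 x) = lame f 1 x := by simpa using hu x hx
  have hvx : lame f 1 x * lame f 2 x * (h 1 x - h 2 x) = -lame f 0 x := by simpa using hv x hx
  have hd := fun i => hf.lame_mul_pderiv hx i
  have hdu := fun i => hf.pderiv_mul_mul_factor_sub hh.smooth hu hx i
  have hdv := fun i => hf.pderiv_mul_mul_factor_sub hh.smooth hv hx i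
  simp only [one_mul, neg_one_mul] at hdu hdv
  have c20 : lame f 2 x * pderiv 0 (h 2) x = (h 0 x - h 2 x) * pderiv 0 (lame f 2) x := by
    rw [hh.dx x hx, hf.1.principalCurvature_eq hx (by decide), rotationCoeff, hh.fst x hx]
    field_simp
    ring
  have c21 : lame f 2 x * pderiv 1 (h 2) x = (h 1 x - h 2 x) * pderiv 1 (lame f 2) x := by
    rw [hh.dy x hx, hf.1.principalCurvature_eq hx (by decide), rotationCoeff, hh.snd x hx]
    field_simp
    ring
  have c22 : pderiv 2 (h 2) x * lame f 2 x ^ 3 =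
      lame f 1 x * pderiv 2 (lame f 0) x - lame f 0 x * pderiv 2 (lame f 1) x := by
    rw [hh.dz x hx, hf.1.principalCurvature_eq hx (by decide),
      hf.1.principalCurvature_eq hx (by decide), rotationCoeff, rotationCoeff]
    field_simp
    ring
  intro i j hij
  fin_cases i <;> fin_cases j <;> simp only [Fin.zero_eta, Fin.mk_one, Fin.reduceFinMk] at hij ⊢
  · exact absurd rfl hij
  · exact factor_deriv_first_second n1 n2 hG hux hvx (hd 1) (hdu 1) c21
  · exact factor_deriv_first_of_third n2 hG hux (hd 2) (hdu 2) c22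
  · exact factor_deriv_second_first n1 n2 hG hux hvx (hd 0) (hdv 0) c20
  · exact absurd rfl hij
  · exact factor_deriv_second_of_third n2 hG hvx (hd 2) (hdv 2) c22
  · exact c20
  · exact c21
  · exact absurd rfl hij

end IsGuichardNet

/-! ### Integrability of the system for `h₂` -/

/-- The coefficients of the differential of `h₃` for an associated system of a Guichard net. -/
noncomputable def associatedForm (f : R3 → R3) : Fin 3 → R3 → ℝ :=
  ![fun x => lame f 1 x * rotationCoeff f 0 2 x / (lame f 2 x * lame f 2 x),
    fun x => -1 * (lame f 0 x * rotationCoeff f 1 2 x) / (lame f 2 x * lame f 2 x),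
    fun x => (lame f 1 x * rotationCoeff f 2 0 x - lame f 0 x * rotationCoeff f 2 1 x) /
      (lame f 2 x * lame f 2 x)]

namespace IsGuichardNet

variable {U : Set R3} {f : R3 → R3} (hf : IsGuichardNet U f) {x : R3}

include hf

/-- Rotation coefficients encode `∂ᵢHⱼ` for `i ≠ j`; the Guichard relation supplies the diagonal
derivatives, closing the first-order system for the `Hᵢ`. -/
theorem pderiv_lame_self (hx : x ∈ U) {i j : Fin 3} (hij : i ≠ j) (hi : i ≠ 2) (hj : j ≠ 2) :
    pderiv i (lame f i) x =
      lame f 2 x * rotationCoeff f i 2 x - lame f j x * rotationCoeff f i j x := by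
  have n := hf.1.lame_ne_zero hx i
  have h := hf.lame_mul_pderiv hx i
  have h2 := hf.1.pderiv_lame hx i 2
  have hj' := hf.1.pderiv_lame hx i j
  have hc : lame f i x * pderiv i (lame f i) x + lame f j x * pderiv i (lame f j) x =
      lame f 2 x * pderiv i (lame f 2) x := by
    fin_cases i <;> fin_cases j <;> simp at hij hi hj ⊢ <;> simp at h <;> linarith
  refine mul_left_cancel₀ n ?_
  rw [h2, hj'] at hc
  linear_combination hc

theorem pderiv_lame_two (hx : x ∈ U) :
    pderiv 2 (lame f 2) x =
      lame f 0 x * rotationCoeff f 2 0 x + lame f 1 x * rotationCoeff f 2 1 x := by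
  have h := hf.lame_mul_pderiv hx 2
  rw [hf.1.pderiv_lame hx 2 0, hf.1.pderiv_lame hx 2 1] at h
  refine mul_left_cancel₀ (hf.1.lame_ne_zero hx 2) ?_
  linear_combination -h

/-- A consequence of the Lamé equations and the derivative of the Guichard condition. -/
theorem pderiv_rotationCoeff_sub (hx : x ∈ U) {i j : Fin 3} (hij : i ≠ j) (hi : i ≠ 2)
    (hj : j ≠ 2) :
    pderiv i (rotationCoeff f 2 i) x =
      pderiv 2 (rotationCoeff f i 2) x - rotationCoeff f 2 j x * rotationCoeff f i j x := by
  have hH := fun k => hf.1.differentiableAt_lame hx k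
  have hβ := fun k l => hf.1.differentiableAt_rotationCoeff hx k l
  -- Equating both expressions for the mixed derivative of `Hᵢ`, everything but the claim cancels up
  -- to a factor `H₂`.
  have h := pderiv_comm hf.1.isOpen (hf.1.contDiffOn_lame i) hx i 2
  rw [pderiv_congr hf.1.isOpen (fun y hy => hf.pderiv_lame_self hy hij hi hj) hx,
    pderiv_congr hf.1.isOpen (fun y hy => hf.1.pderiv_lame hy 2 i) hx,
    pderiv_sub ((hH 2).fun_mul (hβ i 2)) ((hH j).fun_mul (hβ i j)), pderiv_mul (hH 2) (hβ i 2),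
    pderiv_mul (hH j) (hβ i j), pderiv_mul (hH 2) (hβ 2 i),
    hf.1.pderiv_rotationCoeff hx hij hi hj, hf.1.pderiv_lame hx i 2, hf.1.pderiv_lame hx 2 j] at h
  have h2 : pderiv 2 (lame f 2) x =
      lame f i x * rotationCoeff f 2 i x + lame f j x * rotationCoeff f 2 j x := by
    have := hf.pderiv_lame_two hx
    fin_cases i <;> fin_cases j <;> simp at hij hi hj ⊢ <;> linarith
  refine mul_left_cancel₀ (hf.1.lame_ne_zero hx 2) ?_
  rw [h2] at h
  linear_combination h

theorem contDiffOn_associatedForm (i : Fin 3) : ContDiffOn ℝ ∞ (associatedForm f i) U := by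
  have hH := fun k => hf.1.contDiffOn_lame k
  have hβ := fun k l => hf.1.contDiffOn_rotationCoeff k l
  have hn : ∀ y ∈ U, lame f 2 y * lame f 2 y ≠ 0 := fun y hy =>
    mul_ne_zero (hf.1.lame_ne_zero hy 2) (hf.1.lame_ne_zero hy 2)
  fin_cases i
  · exact ((hH 1).mul (hβ 0 2)).div ((hH 2).mul (hH 2)) hn
  · exact (contDiffOn_const.mul ((hH 0).mul (hβ 1 2))).div ((hH 2).mul (hH 2)) hn
  · exact (((hH 1).mul (hβ 2 0)).sub ((hH 0).mul (hβ 2 1))).div ((hH 2).mul (hH 2)) hn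

/-- All three coefficients share the denominator `H₂²`; the factor `H₂³` clears the quotient rule,
so closedness becomes polynomial. -/
theorem pderiv_associatedForm {i : Fin 3} {g : R3 → ℝ} (hx : x ∈ U)
    (hg : associatedForm f i = fun y => g y / (lame f 2 y * lame f 2 y)) (j : Fin 3) :
    lame f 2 x ^ 3 * pderiv j (associatedForm f i) x =
      lame f 2 x * pderiv j g x - 2 * g x * pderiv j (lame f 2) x := by
  have n := hf.1.lame_ne_zero hx 2
  have hd := differentiableAt_of_contDiffOn hf.1.isOpen (hf.contDiffOn_associatedForm i) hx
  have hH := hf.1.differentiableAt_lame hx 2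
  have he : EqOn (fun y => associatedForm f i y * (lame f 2 y * lame f 2 y)) g U := fun y hy => by
    have := hf.1.lame_ne_zero hy 2
    simp only [hg]
    field_simp
  have h := pderiv_congr hf.1.isOpen he hx j
  have h' := he hx
  rw [pderiv_mul hd (hH.fun_mul hH), pderiv_mul hH hH] at h
  dsimp only at h'
  rw [← h, ← h']
  ring

theorem closed_associatedForm (hx : x ∈ U) (i j : Fin 3) :
    pderiv j (associatedForm f i) x = pderiv i (associatedForm f j) x := by
  have n := hf.1.lame_ne_zero hx 2
  have hG := hf.sq_add_sq hx
  have hH := fun k => hf.1.differentiableAt_lame hx k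
  have hβ := fun k l => hf.1.differentiableAt_rotationCoeff hx k l
  have D0 : ∀ j, lame f 2 x ^ 3 * pderiv j (associatedForm f 0) x =
      lame f 2 x * (pderiv j (lame f 1) x * rotationCoeff f 0 2 x +
        lame f 1 x * pderiv j (rotationCoeff f 0 2) x) -
      2 * (lame f 1 x * rotationCoeff f 0 2 x) * pderiv j (lame f 2) x := fun j => by
    rw [hf.pderiv_associatedForm hx rfl, pderiv_mul (hH 1) (hβ 0 2)]
  have D1 : ∀ j, lame f 2 x ^ 3 * pderiv j (associatedForm f 1) x =
      -lame f 2 x * (pderiv j (lame f 0) x * rotationCoeff f 1 2 x +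
        lame f 0 x * pderiv j (rotationCoeff f 1 2) x) +
      2 * (lame f 0 x * rotationCoeff f 1 2 x) * pderiv j (lame f 2) x := fun j => by
    rw [hf.pderiv_associatedForm hx rfl,
      pderiv_mul (differentiableAt_const _) ((hH 0).fun_mul (hβ 1 2)), pderiv_const,
      pderiv_mul (hH 0) (hβ 1 2)]
    ring
  have D2 : ∀ j, lame f 2 x ^ 3 * pderiv j (associatedForm f 2) x =
      lame f 2 x * (pderiv j (lame f 1) x * rotationCoeff f 2 0 x +
        lame f 1 x * pderiv j (rotationCoeff f 2 0) x -
        (pderiv j (lame f 0) x * rotationCoeff f 2 1 x +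
        lame f 0 x * pderiv j (rotationCoeff f 2 1) x)) -
      2 * (lame f 1 x * rotationCoeff f 2 0 x - lame f 0 x * rotationCoeff f 2 1 x) *
        pderiv j (lame f 2) x := fun j => by
    rw [hf.pderiv_associatedForm hx rfl,
      pderiv_sub ((hH 1).fun_mul (hβ 2 0)) ((hH 0).fun_mul (hβ 2 1)),
      pderiv_mul (hH 1) (hβ 2 0), pderiv_mul (hH 0) (hβ 2 1)]
  have p00 := hf.pderiv_lame_self hx (i := 0) (j := 1) (by decide) (by decide) (by decide)
  have p11 := hf.pderiv_lame_self hx (i := 1) (j := 0) (by decide) (by decide) (by decide)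
  have p22 := hf.pderiv_lame_two hx
  have L := fun i j => hf.1.pderiv_lame hx i j
  -- After all derivatives are expressed by `H`, `β` and `∂₂β`, the two sides of each identity
  -- differ by a multiple of the Guichard relation.
  have c01 : pderiv 1 (associatedForm f 0) x = pderiv 0 (associatedForm f 1) x := by
    refine mul_left_cancel₀ (pow_ne_zero 3 n) ?_
    rw [D0, D1, p00, p11, L 1 2, L 0 2,
      hf.1.pderiv_rotationCoeff hx (i := 0) (j := 2) (k := 1) (by decide) (by decide) (by decide),
      hf.1.pderiv_rotationCoeff hx (i := 1) (j := 2) (k := 0) (by decide) (by decide) (by decide)]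
    linear_combination (-2 * rotationCoeff f 0 2 x * rotationCoeff f 1 2 x) * hG
  have c02 : pderiv 2 (associatedForm f 0) x = pderiv 0 (associatedForm f 2) x := by
    refine mul_left_cancel₀ (pow_ne_zero 3 n) ?_
    rw [D0, D2, p00, p22, L 0 1, L 2 1, L 0 2,
      hf.pderiv_rotationCoeff_sub hx (i := 0) (j := 1) (by decide) (by decide) (by decide),
      hf.1.pderiv_rotationCoeff hx (i := 2) (j := 1) (k := 0) (by decide) (by decide) (by decide)]
    linear_combination (-2 * rotationCoeff f 0 2 x * rotationCoeff f 2 1 x) * hG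
  have c12 : pderiv 2 (associatedForm f 1) x = pderiv 1 (associatedForm f 2) x := by
    refine mul_left_cancel₀ (pow_ne_zero 3 n) ?_
    rw [D1, D2, p11, p22, L 1 0, L 2 0, L 1 2,
      hf.pderiv_rotationCoeff_sub hx (i := 1) (j := 0) (by decide) (by decide) (by decide),
      hf.1.pderiv_rotationCoeff hx (i := 2) (j := 0) (k := 1) (by decide) (by decide) (by decide)]
    linear_combination (2 * rotationCoeff f 1 2 x * rotationCoeff f 2 0 x) * hG
  fin_cases i <;> fin_cases j
  · rfl
  · exact c01
  · exact c02
  · exact c01.symm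
  · rfl
  · exact c12
  · exact c02.symm
  · exact c12.symm
  · rfl

theorem exists_solvesAssociatedEquations (hsc : IsSimplyConnected U) {p : R3} (hp : p ∈ U) (c : ℝ) :
    ∃ h : Fin 3 → R3 → ℝ, SolvesAssociatedEquations U f h ∧ h 2 p = c := by
  obtain ⟨t, ht, ht', htp⟩ := exists_primitive_of_simplyConnected hf.1.isOpen hsc
    hf.contDiffOn_associatedForm (fun x hx i j => hf.closed_associatedForm hx i j) hp c
  have hH := fun k => hf.1.contDiffOn_lame k
  have hn := fun (k : Fin 3) (y : R3) (hy : y ∈ U) => hf.1.lame_ne_zero hy k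
  refine ⟨![fun x => t x + lame f 1 x / (lame f 0 x * lame f 2 x),
    fun x => t x - lame f 0 x / (lame f 1 x * lame f 2 x), t],
    ⟨fun i => ?_, fun x hx => ?_, fun x hx => ?_, fun x hx => ?_, fun x _ => rfl, fun x _ => rfl⟩,
    htp⟩
  · fin_cases i
    · exact ht.add ((hH 1).div ((hH 0).mul (hH 2))
        fun y hy => mul_ne_zero (hn 0 y hy) (hn 2 y hy))
    · exact ht.sub ((hH 0).div ((hH 1).mul (hH 2))
        fun y hy => mul_ne_zero (hn 1 y hy) (hn 2 y hy))
    · exact ht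
  all_goals
    have n0 := hn 0 x hx
    have n1 := hn 1 x hx
    have n2 := hn 2 x hx
    refine (ht' x hx _).trans ?_
  · rw [hf.1.principalCurvature_eq hx (by decide)]
    simp only [associatedForm, Matrix.cons_val]
    field_simp
  · rw [hf.1.principalCurvature_eq hx (by decide)]
    simp only [associatedForm, Matrix.cons_val]
    field_simp
  · rw [hf.1.principalCurvature_eq hx (by decide), hf.1.principalCurvature_eq hx (by decide)]
    simp only [associatedForm, Matrix.cons_val]
    field_simp
    ring

/-! ### Associated systems: sign, dual system and the relation with value one -/

/-- The factors of an associated system differ pairwise by fixed quantities, up to a common sign. -/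
theorem exists_sign_of_isAssociatedSystem {g : R3 → R3} {h : Fin 3 → R3 → ℝ}
    (hg : IsCombescureTransform U f h g)
    (hd : ∀ x ∈ U, ∀ j k : Fin 3, j ≠ k →
      guichardSign j / lame f j x ^ 2 + guichardSign k / lame f k x ^ 2 = (h j x - h k x) ^ 2) :
    ∃ σ : ℝ, (σ = 1 ∨ σ = -1) ∧
      (∀ x ∈ U, lame f 0 x * lame f 2 x * (h 0 x - h 2 x) = σ * lame f 1 x) ∧
      ∀ x ∈ U, lame f 1 x * lame f 2 x * (h 1 x - h 2 x) = -σ * lame f 0 x := by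
  have key : ∀ x ∈ U, (lame f 0 x * lame f 2 x * (h 0 x - h 2 x) = lame f 1 x ∧
        lame f 1 x * lame f 2 x * (h 1 x - h 2 x) = -lame f 0 x) ∨
      (lame f 0 x * lame f 2 x * (h 0 x - h 2 x) = -lame f 1 x ∧
        lame f 1 x * lame f 2 x * (h 1 x - h 2 x) = lame f 0 x) := fun x hx => by
    have ha := hd x hx 0 1 (by decide)
    have hb := hd x hx 0 2 (by decide)
    have hc := hd x hx 1 2 (by decide)
    simp only [guichardSign, Matrix.cons_val, neg_div, ← sub_eq_add_neg] at ha hb hc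
    exact factor_differences_of_squares (hf.1.lame_ne_zero hx 0) (hf.1.lame_ne_zero hx 1)
      (hf.1.lame_ne_zero hx 2) (hf.sq_add_sq hx) ha hb hc
  have hH := fun k => (hf.1.contDiffOn_lame k).continuousOn
  have hh := fun k => (hf.1.contDiffOn_factor hg k).continuousOn
  -- Two continuous functions with equal squares, one without zeros, agree up to a global sign on a
  -- connected set. The second relation inherits the sign, since the other case would force `H₁ =
  -- 0`.
  have hconst := hf.1.isConnected.isPreconnected.eq_or_eq_neg_of_sq_eq
    (((hH 0).mul (hH 2)).mul ((hh 0).sub (hh 2))) (hH 1)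
    (fun x hx => by rcases key x hx with h | h <;> simp [h.1])
    (fun {x} hx => hf.1.lame_ne_zero hx 1)
  rcases hconst with hc | hc
  · refine ⟨1, Or.inl rfl, fun x hx => by simpa using hc hx, fun x hx => ?_⟩
    rcases key x hx with h' | h'
    · simpa using h'.2
    · have h1 : lame f 0 x * lame f 2 x * (h 0 x - h 2 x) = lame f 1 x := hc hx
      exact absurd (by linarith [h'.1]) (hf.1.lame_ne_zero hx 1)
  · refine ⟨-1, Or.inr rfl, fun x hx => by simpa using hc hx, fun x hx => ?_⟩
    rcases key x hx with h' | h'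
    · have h1 : lame f 0 x * lame f 2 x * (h 0 x - h 2 x) = -lame f 1 x := hc hx
      exact absurd (by linarith [h'.1]) (hf.1.lame_ne_zero hx 1)
    · simpa using h'.2

/-- The vector `(h₀H₀, h₁H₁)` is `h₂(H₀, H₁) + (σ/H₂)(H₁, -H₀)`, an orthogonal sum of vectors whose
squared lengths are `h₂²H₂²` and `1`. -/
theorem sum_sq_eq_one {h : Fin 3 → R3 → ℝ} {σ : ℝ} (hσ : σ = 1 ∨ σ = -1) (hx : x ∈ U)
    (hu : lame f 0 x * lame f 2 x * (h 0 x - h 2 x) = σ * lame f 1 x)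
    (hv : lame f 1 x * lame f 2 x * (h 1 x - h 2 x) = -σ * lame f 0 x) :
    (h 0 x * lame f 0 x) ^ 2 + (h 1 x * lame f 1 x) ^ 2 - (h 2 x * lame f 2 x) ^ 2 = 1 := by
  have n0 := hf.1.lame_ne_zero hx 0
  have n1 := hf.1.lame_ne_zero hx 1
  have n2 := hf.1.lame_ne_zero hx 2
  have hG := hf.sq_add_sq hx
  have hσ2 : σ ^ 2 = 1 := by rcases hσ with rfl | rfl <;> norm_num
  have e0 : h 0 x * lame f 0 x = h 2 x * lame f 0 x + σ * lame f 1 x / lame f 2 x := by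
    field_simp
    linear_combination hu
  have e1 : h 1 x * lame f 1 x = h 2 x * lame f 1 x - σ * lame f 0 x / lame f 2 x := by
    field_simp
    linear_combination hv
  rw [e0, e1]
  field_simp
  linear_combination (h 2 x ^ 2 * lame f 2 x ^ 2 + σ ^ 2) * hG + lame f 2 x ^ 2 * hσ2

/-- The factors of the dual system satisfy the compatibility conditions. -/
theorem satisfiesCombescureEquations_dual {h : Fin 3 → R3 → ℝ}
    (hs : ∀ i, ContDiffOn ℝ ∞ (h i) U) (he : SatisfiesCombescureEquations U f h)
    (hd : ∀ x ∈ U, ∀ j k : Fin 3, j ≠ k →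
      guichardSign j / lame f j x ^ 2 + guichardSign k / lame f k x ^ 2 = (h j x - h k x) ^ 2) :
    SatisfiesCombescureEquations U f
      fun i x => -h i x ^ 2 + guichardSign i / lame f i x ^ 2 := by
  intro x hx i j hij
  have n := hf.1.lame_ne_zero hx i
  have hdh := differentiableAt_of_contDiffOn hf.1.isOpen (hs i) hx
  have hdH := hf.1.differentiableAt_lame hx i
  have hsm : ContDiffOn ℝ ∞ (fun x => -h i x ^ 2 + guichardSign i / lame f i x ^ 2) U :=
    ((hs i).pow 2).neg.add (contDiffOn_const.div ((hf.1.contDiffOn_lame i).pow 2)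
      fun y hy => pow_ne_zero 2 (hf.1.lame_ne_zero hy i))
  have hds := differentiableAt_of_contDiffOn hf.1.isOpen hsm hx
  -- With `hᵢ⋆` the dual factor, `Hᵢ²hᵢ⋆ + (Hᵢhᵢ)² = εᵢ` is constant. Its derivative, the equation
  -- for `∂ⱼhᵢ` and `hᵢ⋆ + hⱼ⋆ = -2hᵢhⱼ` give the claim.
  have hc : EqOn (fun y => lame f i y * lame f i y *
      (-h i y ^ 2 + guichardSign i / lame f i y ^ 2) +
      (lame f i y * h i y) * (lame f i y * h i y)) (fun _ => guichardSign i) U := fun y hy => by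
    have := hf.1.lame_ne_zero hy i
    dsimp only
    field_simp
    ring
  have h1 := pderiv_congr hf.1.isOpen hc hx j
  have hHh := hdH.fun_mul hdh
  rw [pderiv_const, pderiv_add ((hdH.fun_mul hdH).fun_mul hds) (hHh.fun_mul hHh),
    pderiv_mul (hdH.fun_mul hdH) hds, pderiv_mul hdH hdH, pderiv_mul hHh hHh,
    pderiv_mul hdH hdh] at h1
  have h2 := he x hx i j hij
  have h3 := hd x hx i j hij
  refine mul_left_cancel₀ n ?_
  linear_combination h1 - 2 * lame f i x * h i x * h2 -
    lame f i x * pderiv j (lame f i) x * h3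

theorem exists_factors_of_isAssociatedSystem {g : R3 → R3} (hg : IsAssociatedSystem U f g) :
    ∃ h : Fin 3 → R3 → ℝ, IsCombescureTransform U f h g ∧ ∃ σ : ℝ, (σ = 1 ∨ σ = -1) ∧
      (∀ x ∈ U, lame f 0 x * lame f 2 x * (h 0 x - h 2 x) = σ * lame f 1 x) ∧
      ∀ x ∈ U, lame f 1 x * lame f 2 x * (h 1 x - h 2 x) = -σ * lame f 0 x := by
  obtain ⟨h, hgh, hloc⟩ := hg
  refine ⟨h, hgh, hf.exists_sign_of_isAssociatedSystem hgh fun x hx j k hjk => ?_⟩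
  obtain ⟨V, -, hxV, -, hstar, -, -, h1, h2⟩ := hloc x hx
  have h3 := h1 x hxV j k hjk
  rw [h2 x hxV, h2 x hxV] at h3
  linear_combination h3

theorem isAssociatedSystem_iff (g : R3 → R3) :
    IsAssociatedSystem U f g ↔ ∃ σ : ℝ, (σ = 1 ∨ σ = -1) ∧ ∃ h : Fin 3 → R3 → ℝ,
      SolvesAssociatedEquations U f h ∧ IsCombescureTransform U f h (fun x => σ • g x) := by
  constructor
  · intro hg
    obtain ⟨h, hgh, σ, hσ, hu, hv⟩ := hf.exists_factors_of_isAssociatedSystem hg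
    have hσ2 : σ * σ = 1 := by rcases hσ with rfl | rfl <;> norm_num
    have hσg := hgh.const_smul hf.1.isOpen σ
    refine ⟨σ, hσ, _, hf.solvesAssociatedEquations_of (hf.1.contDiffOn_factor hσg)
      (hf.1.satisfiesCombescureEquations hσg) (fun x hx => ?_) (fun x hx => ?_), hσg⟩
    · linear_combination σ * hu x hx + lame f 1 x * hσ2
    · linear_combination σ * hv x hx - lame f 0 x * hσ2
  · rintro ⟨σ, hσ, h, hh, hσg⟩
    have hσ2 : σ * σ = 1 := by rcases hσ with rfl | rfl <;> norm_num
    have hg : IsCombescureTransform U f (fun i x => σ * h i x) g := by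
      simpa [smul_smul, hσ2] using hσg.const_smul hf.1.isOpen σ
    have hs := hf.1.contDiffOn_factor hg
    have hd : ∀ x ∈ U, ∀ j k : Fin 3, j ≠ k →
        guichardSign j / lame f j x ^ 2 + guichardSign k / lame f k x ^ 2 =
          (σ * h j x - σ * h k x) ^ 2 := by
      intro x hx j k hjk
      have n0 := hf.1.lame_ne_zero hx 0
      have n1 := hf.1.lame_ne_zero hx 1
      have n2 := hf.1.lame_ne_zero hx 2
      have hG := hf.sq_add_sq hx
      have e : (σ * h j x - σ * h k x) ^ 2 = (h j x - h k x) ^ 2 := by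
        linear_combination (h j x - h k x) ^ 2 * hσ2
      have e01 : 1 / lame f 0 x ^ 2 + 1 / lame f 1 x ^ 2 = (h 0 x - h 1 x) ^ 2 := by
        rw [hh.fst x hx, hh.snd x hx]
        field_simp
        linear_combination -(lame f 0 x ^ 2 + lame f 1 x ^ 2) * hG
      have e02 : 1 / lame f 0 x ^ 2 + -1 / lame f 2 x ^ 2 = (h 0 x - h 2 x) ^ 2 := by
        rw [hh.fst x hx]
        field_simp
        linear_combination -hG
      have e12 : 1 / lame f 1 x ^ 2 + -1 / lame f 2 x ^ 2 = (h 1 x - h 2 x) ^ 2 := by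
        rw [hh.snd x hx]
        field_simp
        linear_combination -hG
      rw [e]
      fin_cases j <;> fin_cases k <;>
        simp only [guichardSign, Matrix.cons_val, Fin.zero_eta, Fin.mk_one, Fin.reduceFinMk,
          ne_eq, not_true_eq_false] at hjk ⊢ <;>
        first
          | exact e01 | exact e02 | exact e12
          | linear_combination e01 | linear_combination e02 | linear_combination e12
    have he := hf.satisfiesCombescureEquations_dual hs (hf.1.satisfiesCombescureEquations hg) hd
    refine ⟨_, hg, fun p hp => ?_⟩
    -- The dual system is only required locally, so a ball suffices and `U` need not be simply
    -- connected.
    obtain ⟨r, hr, hrU⟩ := Metric.isOpen_iff.1 hf.1.isOpen p hp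
    obtain ⟨fstar, hfstar⟩ := hf.1.exists_combescureTransform_ball
      (h := fun i x => -(σ * h i x) ^ 2 + guichardSign i / lame f i x ^ 2) hrU (fun i =>
      ((hs i).pow 2).neg.add (contDiffOn_const.div ((hf.1.contDiffOn_lame i).pow 2)
        fun y hy => pow_ne_zero 2 (hf.1.lame_ne_zero hy i))) he
    refine ⟨_, Metric.isOpen_ball, Metric.mem_ball_self hr, hrU, _, fstar, hfstar,
      fun x hx j k hjk => ?_, fun x hx i => rfl⟩
    linear_combination hd x (hrU hx) j k hjk

theorem sum_sq_eq_one_of_isAssociatedSystem {g : R3 → R3} (hg : IsAssociatedSystem U f g)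
    {h : Fin 3 → R3 → ℝ} (hgh : IsCombescureTransform U f h g) (hx : x ∈ U) :
    (h 0 x * lame f 0 x) ^ 2 + (h 1 x * lame f 1 x) ^ 2 - (h 2 x * lame f 2 x) ^ 2 = 1 := by
  obtain ⟨h', hgh', σ, hσ, hu, hv⟩ := hf.exists_factors_of_isAssociatedSystem hg
  simp only [hf.1.factor_unique hgh hgh' hx]
  exact hf.sum_sq_eq_one hσ hx (hu x hx) (hv x hx)

theorem isChiSystem_of_isAssociatedSystem {g : R3 → R3} (hg : IsAssociatedSystem U f g)
    (hj : ∀ x ∈ U, jacobian g x ≠ 0) : IsChiSystem U g fun _ => 1 := by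
  obtain ⟨h, hgh, -⟩ := id hg
  have ho : IsTriplyOrthogonalSystem U g := by
    refine ⟨hf.1.isOpen, hf.1.isConnected, hgh.1, hj, fun x hx i j hij => ?_⟩
    rw [hgh.2 x hx, hgh.2 x hx, real_inner_smul_left, real_inner_smul_right,
      hf.1.orthogonal x hx i j hij, mul_zero, mul_zero]
  -- The normals of `g` are formed from `g` itself and may be opposite to those of `f`, so only the
  -- squares of the coefficients are compared.
  have key : ∀ x ∈ U, ∀ i, lame g i x ^ 2 = (h i x * lame f i x) ^ 2 := by
    intro x hx i
    have h1 := hgh.2 x hx i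
    rw [ho.pderiv_eq hx, hf.1.pderiv_eq hx, smul_smul] at h1
    have h2 := congrArg (fun v => inner ℝ v v) h1
    simp only [real_inner_smul_left, real_inner_smul_right, ho.inner_unitNormal_self hx,
      hf.1.inner_unitNormal_self hx] at h2
    linear_combination h2
  refine ⟨ho, fun x hx => ?_⟩
  rw [key x hx, key x hx, key x hx]
  exact hf.sum_sq_eq_one_of_isAssociatedSystem hg hgh hx

end IsGuichardNet

end GuichardNet

theorem mainTheorem7 (U : Set GuichardNet.R3) (f : GuichardNet.R3 → GuichardNet.R3)
    (hf : GuichardNet.IsGuichardNet U f) :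
    -- the associated systems are, up to the sign of `fhat`, exactly those given by the equations
    (∀ fhat : GuichardNet.R3 → GuichardNet.R3,
      GuichardNet.IsAssociatedSystem U f fhat ↔
        ∃ σ : ℝ, (σ = 1 ∨ σ = -1) ∧ ∃ h : Fin 3 → GuichardNet.R3 → ℝ,
          GuichardNet.SolvesAssociatedEquations U f h ∧
          GuichardNet.IsCombescureTransform U f h (fun x => σ • fhat x)) ∧
    -- the coefficients `hᵢ Hᵢ` of every associated system satisfy the trace condition with `χ = 1`,
    -- and an associated system is a `1`-system as soon as it is regular
    (∀ fhat : GuichardNet.R3 → GuichardNet.R3, GuichardNet.IsAssociatedSystem U f fhat →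
      (∀ h : Fin 3 → GuichardNet.R3 → ℝ, GuichardNet.IsCombescureTransform U f h fhat →
        ∀ x ∈ U, (h 0 x * GuichardNet.lame f 0 x) ^ 2 + (h 1 x * GuichardNet.lame f 1 x) ^ 2
          - (h 2 x * GuichardNet.lame f 2 x) ^ 2 = 1) ∧
      ((∀ x ∈ U, GuichardNet.jacobian fhat x ≠ 0) →
        GuichardNet.IsChiSystem U fhat (fun _ => 1))) ∧
    -- on simply connected domains the equations can be integrated with arbitrary initial values
    (IsSimplyConnected U → ∀ p ∈ U, ∀ (c : ℝ) (q : GuichardNet.R3),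
      ∃ (h : Fin 3 → GuichardNet.R3 → ℝ) (fhat : GuichardNet.R3 → GuichardNet.R3),
        GuichardNet.SolvesAssociatedEquations U f h ∧
        GuichardNet.IsCombescureTransform U f h fhat ∧ h 2 p = c ∧ fhat p = q) :=
  ⟨hf.isAssociatedSystem_iff,
    fun _ hg => ⟨fun _ hgh _ hx => hf.sum_sq_eq_one_of_isAssociatedSystem hg hgh hx,
      hf.isChiSystem_of_isAssociatedSystem hg⟩,
    fun hsc p hp c q => by
      obtain ⟨h, hh, hc⟩ := hf.exists_solvesAssociatedEquations hsc hp c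
      obtain ⟨g, hg, hgq⟩ := hf.1.exists_combescureTransform hsc hh.smooth
        (hf.satisfiesCombescureEquations_of_solves hh) hp q
      exact ⟨h, g, hh, hg, hc, hgq⟩⟩
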